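/- Let $d\in\mathbb N$ and let $\varphi:\mathbb R^d\to\mathbb R$ be $K$-Lipschitz and $\lambda$-concave for some $K,\lambda\ge 0$ (that is, $y\mapsto\varphi(y)-\tfrac{\lambda}{2}|y|^2$ is concave). Fix $t>0$. Let $f^*(x)=\sup_y\,(x\cdot y-f(y))$ denote the Legendre transform, and put $\psi_t(y)=\tfrac12|y|^2+t\varphi(y)$, $w_t=\psi_t^*$, $T_t=\nabla\psi_t^{**}$. Let $\mu_t$ be the Monge--Ampère measure of $w_t$, $\mu_t(B)=|\partial w_t(B)|$ for Borel $B$, where $\partial w_t$ is the subgradient and $|\cdot|$ is Lebesgue measure. Define $\breve\varphi$ by $\psi_t^{**}(y)=\tfrac12|y|^2+t\breve\varphi(y)$, and let $$\breve u_s(x)=\inf_y\Big(\frac{|x-y|^2}{2s}+\breve\varphi(y)\Big),\qquad s>0 .$$ Let $\partial\breve u_s(x)$ be the set of all $q\in\mathbb R^d$ with $\breve u_s(z)\le \breve u_s(x)+q\cdot(z-x)+\tfrac12\lambda_s|z-x|^2$ for all $z$, where $\lambda_s=\lambda/(1+\lambda s)$. The modified Lagrangian flow $(\breve X_s)_{0\le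 s\le t}$ consists, for each $y$, of the Lipschitz path $s\mapsto\breve X_s(y)$ on $[0,t]$ that satisfies $$\partial_s\breve X_s(y)\in\partial\breve u_s(\breve X_s(y))\ \text{ for a.e. } s\in(0,t),\qquad \breve X_0(y)=y .$$ Then $\psi_t^{**}$ and $\breve\varphi$ are differentiable, the modified Lagrangian flow exists and is unique, and: (i) for $0\le s<t$ the map $\breve X_s:\mathbb R^d\to\mathbb R^d$ is bijective, with $\breve X_s(y)=y+s\nabla\breve\varphi(y)$ for all $y$; (ii) $\breve X_t(y)=T_t(y)$ for all $y\in\mathbb R^d$, and the pushforward $\breve\rho_t=(\breve X_t)_\sharp\mathcal L^d$ of Lebesgue measure satisfies $\breve\rho_t=\mu_t$. -/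

import Mathlib

open MeasureTheory Set

noncomputable section

/-- `f` is `lam`-concave: `y ↦ f y - (lam / 2) |y|²` is concave on the whole space. -/
def LamConcave {d : ℕ} (lam : ℝ) (f : EuclideanSpace ℝ (Fin d) → ℝ) : Prop :=
  ConcaveOn ℝ univ (fun y => f y - lam / 2 * ‖y‖ ^ 2)

/-- The Legendre transform `f^*(x) = sup_y (x · y - f y)`. In the theorem it is applied to
`½|y|² + t φ(y)` with `φ` Lipschitz, and to the transform of that function; the suprema are then
finite. -/
def legendre {d : ℕ} (f : EuclideanSpace ℝ (Fin d) → ℝ) (x : EuclideanSpace ℝ (Fin d)) : ℝ :=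
  ⨆ y : EuclideanSpace ℝ (Fin d), (inner ℝ x y - f y)

/-- The free streaming potential `ψ_t(y) = ½|y|² + t φ(y)`. -/
def streamPotential {d : ℕ} (φ : EuclideanSpace ℝ (Fin d) → ℝ) (t : ℝ)
    (y : EuclideanSpace ℝ (Fin d)) : ℝ :=
  1 / 2 * ‖y‖ ^ 2 + t * φ y

/-- The potential `w_t = ψ_t^*`. -/
def dualPotential {d : ℕ} (φ : EuclideanSpace ℝ (Fin d) → ℝ) (t : ℝ) :
    EuclideanSpace ℝ (Fin d) → ℝ :=
  legendre (streamPotential φ t)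

/-- The convexified potential `ψ_t^{**}`. -/
def convexifiedPotential {d : ℕ} (φ : EuclideanSpace ℝ (Fin d) → ℝ) (t : ℝ) :
    EuclideanSpace ℝ (Fin d) → ℝ :=
  legendre (legendre (streamPotential φ t))

/-- The convexified transport map `T_t = ∇ψ_t^{**}`. -/
def transportMap {d : ℕ} (φ : EuclideanSpace ℝ (Fin d) → ℝ) (t : ℝ)
    (y : EuclideanSpace ℝ (Fin d)) : EuclideanSpace ℝ (Fin d) :=
  gradient (convexifiedPotential φ t) y

/-- The modified initial potential, i.e. the solution (for `t ≠ 0`) of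
`ψ_t^{**}(y) = ½|y|² + t φ̆(y)`. -/
def modifiedPotential {d : ℕ} (φ : EuclideanSpace ℝ (Fin d) → ℝ) (t : ℝ)
    (y : EuclideanSpace ℝ (Fin d)) : ℝ :=
  (convexifiedPotential φ t y - 1 / 2 * ‖y‖ ^ 2) / t

/-- The Hopf-Lax formula `u_s(x) = inf_y (|x - y|² / (2 s) + φ(y))`, used for `s > 0` and
Lipschitz `φ`, where the infimum is finite. -/
def hopfLax {d : ℕ} (φ : EuclideanSpace ℝ (Fin d) → ℝ) (s : ℝ)
    (x : EuclideanSpace ℝ (Fin d)) : ℝ :=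
  ⨅ y : EuclideanSpace ℝ (Fin d), (‖x - y‖ ^ 2 / (2 * s) + φ y)

/-- The differential of a `lam`-concave function: the slopes at `x` of the paraboloids with
Hessian `lam • I` that lie above the graph and touch it at `x`. For a given semi-concave `f` the
set does not depend on the choice of `lam` for which `f` is `lam`-concave. -/
def differential {d : ℕ} (lam : ℝ) (f : EuclideanSpace ℝ (Fin d) → ℝ)
    (x : EuclideanSpace ℝ (Fin d)) : Set (EuclideanSpace ℝ (Fin d)) :=
  {q | ∀ z, f z ≤ f x + inner ℝ q (z - x) + lam / 2 * ‖z - x‖ ^ 2}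

/-- `X` is the Lagrangian flow on the time interval `[0, t]` for the `lam`-concave initial
potential `φ`: for every `y`, the path `s ↦ X s y` is a Lipschitz solution of
`∂_s X_s(y) ∈ ∂u_s(X_s(y))` for a.e. `s ∈ (0, t)`, `X_0(y) = y`, where `u` is given by the
Hopf-Lax formula. (`u_s` is `lam / (1 + lam s)`-concave.) -/
structure IsLagrangianFlow {d : ℕ} (lam : ℝ) (φ : EuclideanSpace ℝ (Fin d) → ℝ) (t : ℝ)
    (X : ℝ → EuclideanSpace ℝ (Fin d) → EuclideanSpace ℝ (Fin d)) : Prop where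
  lipschitz : ∀ y, ∃ L : NNReal, LipschitzOnWith L (fun s => X s y) (Icc 0 t)
  initial : ∀ y, X 0 y = y
  inclusion : ∀ y, ∀ᵐ s ∂(volume.restrict (Ioo 0 t)),
    ∃ q ∈ differential (lam / (1 + lam * s)) (hopfLax φ s) (X s y),
      HasDerivAt (fun r => X r y) q s

/-- The subgradient `∂w(x)` of a convex function. -/
def subgradient {d : ℕ} (w : EuclideanSpace ℝ (Fin d) → ℝ) (x : EuclideanSpace ℝ (Fin d)) :
    Set (EuclideanSpace ℝ (Fin d)) :=
  {y | ∀ z, w x + inner ℝ y (z - x) ≤ w z}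

/-- The image `∂w(B) = ⋃_{x ∈ B} ∂w(x)`. -/
def subgradientImage {d : ℕ} (w : EuclideanSpace ℝ (Fin d) → ℝ)
    (B : Set (EuclideanSpace ℝ (Fin d))) : Set (EuclideanSpace ℝ (Fin d)) :=
  ⋃ x ∈ B, subgradient w x

/-- The Monge-Ampère measure of a convex function `w`, as a function of the Borel set `B`:
the Lebesgue measure of `∂w(B)`. -/
def mongeAmpere {d : ℕ} (w : EuclideanSpace ℝ (Fin d) → ℝ)
    (B : Set (EuclideanSpace ℝ (Fin d))) : ENNReal :=
  volume (subgradientImage w B)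

end

/-!
The argument is the Legendre duality between semiconcavity and strong convexity. If `f` is
`L`-concave, then `f^*` is `L⁻¹`-strongly convex; if `w` is `m`-strongly convex, then `w^*` is
`m⁻¹`-concave and differentiable, and `∇w^*` is the inverse of the multivalued map `∂w`.

Since `ψ_t` is `(1 + λt)`-concave, `w_t` is strongly convex, so `T_t = ∇w_t^*` exists and
`∂w_t(B) = T_t⁻¹(B)`, which is the Monge-Ampère identity. Convexity of
`ψ_t^{**} = ½|·|² + t φ̆` makes `½|·|² + s φ̆` strongly convex for `s < t`, so its gradient map
`y ↦ y + s ∇φ̆(y)` is bijective. As `ŭ_s = s⁻¹ (½|·|² - (½|·|² + s φ̆)^*)`, the same duality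
shows that `ŭ_s` is `λ_s`-concave with gradient `∇φ̆(y)` at `y + s ∇φ̆(y)`: the straight lines are
a flow. They are the only one because the differential of a semiconcave function is one-sided
Lipschitz, so that Gronwall's inequality applies to the squared distance of two flow paths.
-/

open Filter Topology

section Gradient

variable {E : Type*} [NormedAddCommGroup E] [InnerProductSpace ℝ E] [CompleteSpace E]

theorem hasGradientAt_div_two_mul_norm_sq (c : ℝ) (x : E) :
    HasGradientAt (fun z => c / 2 * ‖z‖ ^ 2) (c • x) x := by
  rw [hasGradientAt_iff_hasFDerivAt]
  refine ((hasStrictFDerivAt_norm_sq x).hasFDerivAt.const_mul (c / 2)).congr_fderiv ?_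
  ext v
  simp only [smul_apply, coe_innerSL_apply, smul_eq_mul, nsmul_eq_mul,
    InnerProductSpace.toDual_apply_apply, real_inner_smul_left]
  ring

theorem measurable_gradient [MeasurableSpace E] [BorelSpace E] (f : E → ℝ) :
    Measurable (gradient f) :=
  (InnerProductSpace.toDual ℝ E).symm.continuous.measurable.comp (measurable_fderiv ℝ f)

end Gradient

section Subgradient

variable {d : ℕ} {f g : EuclideanSpace ℝ (Fin d) → ℝ} {lam : ℝ}
  {p q x : EuclideanSpace ℝ (Fin d)}

theorem mem_subgradient_iff_forall_inner_sub_le :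
    p ∈ subgradient f x ↔ ∀ z, inner ℝ p z - f z ≤ inner ℝ p x - f x :=
  forall_congr' fun z => by
    rw [inner_sub_right]
    constructor <;> intro h <;> linarith

theorem mem_differential_iff_mem_subgradient :
    p ∈ differential lam f x ↔
      lam • x - p ∈ subgradient (fun z => lam / 2 * ‖z‖ ^ 2 - f z) x :=
  forall_congr' fun z => by
    have hz : ‖z‖ ^ 2 = ‖x‖ ^ 2 + 2 * inner ℝ x (z - x) + ‖z - x‖ ^ 2 := by
      rw [← norm_add_sq_real, add_sub_cancel]
    beta_reduce
    rw [inner_sub_left, real_inner_smul_left, hz]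
    constructor <;> intro h <;> linarith

theorem eq_of_mem_subgradient_of_hasGradientAt (hq : q ∈ subgradient f x)
    (hf : HasGradientAt f p x) : q = p := by
  have hmin : IsLocalMin (fun z => f z - inner ℝ q z) x :=
    Eventually.of_forall fun z => by
      linarith [mem_subgradient_iff_forall_inner_sub_le.1 hq z]
  have hderiv := hf.hasFDerivAt.sub (innerSL ℝ q).hasFDerivAt
  refine ext_inner_right ℝ fun v => ?_
  have hv : inner ℝ p v - inner ℝ q v = 0 :=
    DFunLike.congr_fun (hmin.hasFDerivAt_eq_zero hderiv) v
  exact (sub_eq_zero.1 hv).symm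

/- Convexity on the segment from `z` through `x` to `x - θ (z - x)` bounds `f x - f z` by a
difference quotient of the majorant. -/
theorem mem_subgradient_of_hasGradientAt_of_le (hf : ConvexOn ℝ univ f)
    (hg : HasGradientAt g p x) (hx : g x = f x) (hle : ∀ z, f z ≤ g z) :
    p ∈ subgradient f x := by
  intro z
  have hlim : Tendsto (fun θ : ℝ => θ⁻¹ • (g (x + θ • (x - z)) - g x)) (𝓝[>] 0)
      (𝓝 (inner ℝ p (x - z))) := by
    simpa using (hg.hasFDerivAt.hasLineDerivAt (x - z)).tendsto_slope_zero_right
  have hquot : f x - f z ≤ inner ℝ p (x - z) := by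
    refine ge_of_tendsto hlim ?_
    filter_upwards [self_mem_nhdsWithin] with θ (hθ : 0 < θ)
    have hx' : (θ / (1 + θ)) • z + (1 / (1 + θ)) • (x + θ • (x - z)) = x := by
      match_scalars <;> field_simp
      ring
    have hconv := hf.2 (mem_univ z) (mem_univ (x + θ • (x - z)))
      (show 0 ≤ θ / (1 + θ) by positivity) (show 0 ≤ 1 / (1 + θ) by positivity)
      (by field_simp; ring)
    rw [hx', smul_eq_mul, smul_eq_mul] at hconv
    field_simp at hconv
    rw [smul_eq_mul, inv_mul_eq_div, le_div_iff₀ hθ, hx]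
    linarith [hle (x + θ • (x - z))]
  rw [← neg_sub x z, inner_neg_right]
  linarith

theorem mem_subgradient_of_hasGradientAt (hf : ConvexOn ℝ univ f) (hp : HasGradientAt f p x) :
    p ∈ subgradient f x :=
  mem_subgradient_of_hasGradientAt_of_le hf hp rfl fun _ => le_rfl

theorem lamConcave_iff_strongConcaveOn : LamConcave lam f ↔ StrongConcaveOn univ (-lam) f := by
  rw [strongConcaveOn_iff_convex, LamConcave]
  simp only [neg_div, neg_mul, ← sub_eq_add_neg]

theorem LamConcave.mem_differential_of_hasGradientAt_of_le (hf : LamConcave lam f)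
    (hg : HasGradientAt g p x) (hx : g x = f x) (hle : ∀ z, g z ≤ f z) :
    p ∈ differential lam f x := by
  have hgrad : HasGradientAt (fun z => lam / 2 * ‖z‖ ^ 2 - g z) (lam • x - p) x := by
    rw [hasGradientAt_iff_hasFDerivAt, map_sub]
    exact (hasGradientAt_div_two_mul_norm_sq lam x).hasFDerivAt.sub hg.hasFDerivAt
  refine mem_differential_iff_mem_subgradient.2
    (mem_subgradient_of_hasGradientAt_of_le ?_ hgrad (by simp only [hx]) fun z => ?_)
  · exact (ConcaveOn.neg hf).congr fun z _ => neg_sub _ _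
  · exact sub_le_sub_left (hle z) _

theorem LamConcave.mem_differential_of_hasGradientAt (hf : LamConcave lam f)
    (hp : HasGradientAt f p x) : p ∈ differential lam f x :=
  hf.mem_differential_of_hasGradientAt_of_le hp rfl fun _ => le_rfl

theorem LamConcave.mem_differential_of_mem_subgradient (hf : LamConcave lam f)
    (hp : p ∈ subgradient f x) : p ∈ differential lam f x := by
  have hgrad : HasGradientAt (fun z => f x + inner ℝ p (z - x)) p x := by
    rw [hasGradientAt_iff_hasFDerivAt]
    exact ((innerSL ℝ p).hasFDerivAt.comp x ((hasFDerivAt_id x).sub_const x)).const_add (f x)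
  exact hf.mem_differential_of_hasGradientAt_of_le hgrad (by simp) hp

theorem LamConcave.hasGradientAt_of_mem_subgradient (hf : LamConcave lam f)
    (hp : p ∈ subgradient f x) : HasGradientAt f p x := by
  rw [hasGradientAt_iff_isLittleO]
  have hquad : (fun z => f z - f x - inner ℝ p (z - x)) =O[𝓝 x] fun z => ‖z - x‖ ^ 2 := by
    refine .of_bound (lam / 2) (.of_forall fun z => ?_)
    rw [Real.norm_of_nonneg (by linarith [hp z]), Real.norm_of_nonneg (by positivity)]
    linarith [hf.mem_differential_of_mem_subgradient hp z]
  exact hquad.trans_isLittleO (Asymptotics.isLittleO_pow_sub_sub x one_lt_two)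

end Subgradient

section StrongConvexity

theorem exists_forall_le_of_strongConvexOn {E : Type*} [NormedAddCommGroup E]
    [InnerProductSpace ℝ E] [FiniteDimensional ℝ E] {f : E → ℝ} {m : ℝ} (hm : 0 < m)
    (hf : StrongConvexOn univ m f) : ∃ x, ∀ z, f x ≤ f z := by
  have hconv := strongConvexOn_iff_convex.1 hf
  have hcont : Continuous fun z => f z - m / 2 * ‖z‖ ^ 2 :=
    continuousOn_univ.1 (hconv.continuousOn isOpen_univ)
  obtain ⟨l, c, hlc, -⟩ := hconv.exists_affine_le_of_lt (𝕜 := ℝ) (mem_univ 0)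
    (sub_one_lt _) isClosed_univ (hcont.lowerSemicontinuous.lowerSemicontinuousOn _)
  have hgrowth : ∀ z, ‖z‖ * (m / 2 * ‖z‖ - ‖l‖) + c ≤ f z := fun z => by
    have haff : l z + c ≤ f z - m / 2 * ‖z‖ ^ 2 := hlc ⟨z, mem_univ z⟩
    have hlz := neg_le_of_abs_le (l.le_opNorm z)
    linarith
  have hcoercive : Tendsto (fun r : ℝ => r * (m / 2 * r - ‖l‖) + c) atTop atTop :=
    tendsto_atTop_add_const_right _ _ <| tendsto_id.atTop_mul_atTop₀ <|
      tendsto_atTop_add_const_right _ _ (tendsto_id.const_mul_atTop (half_pos hm))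
  have hfcont : Continuous f :=
    (hcont.add (by fun_prop : Continuous fun z => m / 2 * ‖z‖ ^ 2)).congr fun z =>
      sub_add_cancel _ _
  exact hfcont.exists_forall_le
    (tendsto_atTop_mono hgrowth (hcoercive.comp (tendsto_norm_cocompact_atTop (E := E))))

theorem exists_mem_subgradient_of_strongConvexOn {d : ℕ} {w : EuclideanSpace ℝ (Fin d) → ℝ}
    {m : ℝ} (hm : 0 < m) (hw : StrongConvexOn univ m w) (y : EuclideanSpace ℝ (Fin d)) :
    ∃ x, y ∈ subgradient w x := by
  have htilt : StrongConvexOn univ m (fun x => w x - inner ℝ y x) :=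
    strongConvexOn_iff_convex.2 <| ((strongConvexOn_iff_convex.1 hw).sub
      ((innerSL ℝ y).toLinearMap.concaveOn convex_univ)).congr fun x _ => sub_right_comm _ _ _
  obtain ⟨x, hx⟩ := exists_forall_le_of_strongConvexOn hm htilt
  exact ⟨x, mem_subgradient_iff_forall_inner_sub_le.2 fun z => by linarith [hx z]⟩

end StrongConvexity

/-- The Legendre transform of `f` is finite: the suprema defining `legendre f` are genuine ones
rather than the value `0` that the supremum of an unbounded set of reals takes. -/
def HasFiniteLegendre {d : ℕ} (f : EuclideanSpace ℝ (Fin d) → ℝ) : Prop :=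
  ∀ x, BddAbove (range fun y => inner ℝ x y - f y)

section Legendre

variable {d : ℕ} {f w : EuclideanSpace ℝ (Fin d) → ℝ} {lam m : ℝ}
  {p x y : EuclideanSpace ℝ (Fin d)}

theorem legendre_eq_of_mem_subgradient (hp : p ∈ subgradient f x) :
    legendre f p = inner ℝ p x - f x :=
  IsGreatest.csSup_eq ⟨mem_range_self x,
    forall_mem_range.2 (mem_subgradient_iff_forall_inner_sub_le.1 hp)⟩

theorem HasFiniteLegendre.inner_sub_le (hf : HasFiniteLegendre f)
    (x y : EuclideanSpace ℝ (Fin d)) : inner ℝ x y - f y ≤ legendre f x :=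
  le_ciSup (hf x) y

theorem HasFiniteLegendre.mem_subgradient_legendre (hf : HasFiniteLegendre f)
    (hp : p ∈ subgradient f x) : x ∈ subgradient (legendre f) p := fun q => by
  rw [legendre_eq_of_mem_subgradient hp, inner_sub_right, real_inner_comm p x,
    real_inner_comm q x]
  linarith [hf.inner_sub_le q x]

theorem HasFiniteLegendre.convexOn_legendre (hf : HasFiniteLegendre f) :
    ConvexOn ℝ univ (legendre f) := by
  refine ⟨convex_univ, fun x₁ _ x₂ _ a b ha hb hab => ciSup_le fun y => ?_⟩
  calc inner ℝ (a • x₁ + b • x₂) y - f y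
      = a * (inner ℝ x₁ y - f y) + b * (inner ℝ x₂ y - f y) := by
        rw [inner_add_left, real_inner_smul_left, real_inner_smul_left]
        linear_combination f y * hab
    _ ≤ a • legendre f x₁ + b • legendre f x₂ := by
        simp only [smul_eq_mul]
        gcongr <;> exact hf.inner_sub_le _ _

/- A competitor `y` for the combination `a x₁ + b x₂` is split into competitors for `x₁` and `x₂`
along `x₁ - x₂`; the step `lam⁻¹` balances the gain in the inner products against the loss of
concavity. -/
theorem LamConcave.strongConvexOn_legendre (hlam : 0 < lam) (hf : LamConcave lam f)
    (hfin : HasFiniteLegendre f) : StrongConvexOn univ lam⁻¹ (legendre f) := by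
  refine ⟨convex_univ, fun x₁ _ x₂ _ a b ha hb hab => ciSup_le fun y => ?_⟩
  set y₁ := y + (b * lam⁻¹) • (x₁ - x₂) with hy₁
  set y₂ := y - (a * lam⁻¹) • (x₁ - x₂) with hy₂
  have hy : a • y₁ + b • y₂ = y := by
    linear_combination (norm := module) hab • y
  have hdist : ‖y₁ - y₂‖ = lam⁻¹ * ‖x₁ - x₂‖ := by
    rw [show y₁ - y₂ = lam⁻¹ • (x₁ - x₂) by
      linear_combination (norm := module) hab • (lam⁻¹ • (x₁ - x₂)),
      norm_smul, Real.norm_of_nonneg (inv_nonneg.2 hlam.le)]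
  have hinner : a * inner ℝ x₁ y₁ + b * inner ℝ x₂ y₂ =
      inner ℝ (a • x₁ + b • x₂) y + a * b * (lam⁻¹ * ‖x₁ - x₂‖ ^ 2) := by
    rw [← real_inner_self_eq_norm_sq, hy₁, hy₂]
    simp only [inner_add_left, inner_add_right, inner_sub_left, inner_sub_right,
      real_inner_smul_left, real_inner_smul_right]
    ring
  have hconc := (lamConcave_iff_strongConcaveOn.1 hf).2 (mem_univ y₁) (mem_univ y₂) ha hb hab
  rw [hy, hdist] at hconc
  have h₁ := mul_le_mul_of_nonneg_left (hfin.inner_sub_le x₁ y₁) ha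
  have h₂ := mul_le_mul_of_nonneg_left (hfin.inner_sub_le x₂ y₂) hb
  have hmod : lam / 2 * (lam⁻¹ * ‖x₁ - x₂‖) ^ 2 = lam⁻¹ / 2 * ‖x₁ - x₂‖ ^ 2 := by
    field_simp
  simp only [smul_eq_mul] at hconc ⊢
  linear_combination h₁ + h₂ + hconc - hinner + a * b * hmod

theorem hasFiniteLegendre_of_strongConvexOn (hm : 0 < m) (hw : StrongConvexOn univ m w) :
    HasFiniteLegendre w := fun y =>
  let ⟨_, hx⟩ := exists_mem_subgradient_of_strongConvexOn hm hw y
  ⟨_, forall_mem_range.2 (mem_subgradient_iff_forall_inner_sub_le.1 hx)⟩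

theorem lamConcave_legendre_of_strongConvexOn (hm : 0 < m) (hw : StrongConvexOn univ m w) :
    LamConcave m⁻¹ (legendre w) := by
  refine lamConcave_iff_strongConcaveOn.2 ⟨convex_univ, fun y₁ _ y₂ _ a b ha hb hab => ?_⟩
  obtain ⟨x₁, hx₁⟩ := exists_mem_subgradient_of_strongConvexOn hm hw y₁
  obtain ⟨x₂, hx₂⟩ := exists_mem_subgradient_of_strongConvexOn hm hw y₂
  have hle := (hasFiniteLegendre_of_strongConvexOn hm hw).inner_sub_le (a • y₁ + b • y₂)
    (a • x₁ + b • x₂)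
  have hconv := hw.2 (mem_univ x₁) (mem_univ x₂) ha hb hab
  have hinner : inner ℝ (a • y₁ + b • y₂) (a • x₁ + b • x₂) =
      a * inner ℝ y₁ x₁ + b * inner ℝ y₂ x₂ - a * b * inner ℝ (y₁ - y₂) (x₁ - x₂) := by
    obtain rfl := eq_sub_of_add_eq hab
    simp only [inner_add_left, inner_add_right, inner_sub_left, inner_sub_right,
      real_inner_smul_left, real_inner_smul_right]
    ring
  have hyoung : inner ℝ (y₁ - y₂) (x₁ - x₂) ≤
      m / 2 * ‖x₁ - x₂‖ ^ 2 + m⁻¹ / 2 * ‖y₁ - y₂‖ ^ 2 := by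
    have hsq : 0 ≤ m / 2 * ‖(x₁ - x₂) - m⁻¹ • (y₁ - y₂)‖ ^ 2 := by positivity
    rw [norm_sub_sq_real, norm_smul, Real.norm_of_nonneg (inv_nonneg.2 hm.le),
      real_inner_smul_right, real_inner_comm] at hsq
    field_simp at hsq ⊢
    linarith
  rw [legendre_eq_of_mem_subgradient hx₁, legendre_eq_of_mem_subgradient hx₂]
  simp only [smul_eq_mul] at hconv ⊢
  linear_combination hle + hconv - hinner + a * b * hyoung

theorem hasGradientAt_legendre_of_mem_subgradient (hm : 0 < m) (hw : StrongConvexOn univ m w)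
    (hy : y ∈ subgradient w x) : HasGradientAt (legendre w) x y :=
  (lamConcave_legendre_of_strongConvexOn hm hw).hasGradientAt_of_mem_subgradient
    ((hasFiniteLegendre_of_strongConvexOn hm hw).mem_subgradient_legendre hy)

theorem mem_subgradient_iff_gradient_legendre_eq (hm : 0 < m) (hw : StrongConvexOn univ m w) :
    y ∈ subgradient w x ↔ gradient (legendre w) y = x := by
  refine ⟨fun hy => (hasGradientAt_legendre_of_mem_subgradient hm hw hy).gradient, ?_⟩
  rintro rfl
  obtain ⟨x, hx⟩ := exists_mem_subgradient_of_strongConvexOn hm hw y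
  rwa [(hasGradientAt_legendre_of_mem_subgradient hm hw hx).gradient]

theorem differentiable_legendre (hm : 0 < m) (hw : StrongConvexOn univ m w) :
    Differentiable ℝ (legendre w) := fun y =>
  let ⟨_, hx⟩ := exists_mem_subgradient_of_strongConvexOn hm hw y
  (hasGradientAt_legendre_of_mem_subgradient hm hw hx).differentiableAt

theorem subgradientImage_eq_preimage_gradient_legendre (hm : 0 < m)
    (hw : StrongConvexOn univ m w) (B : Set (EuclideanSpace ℝ (Fin d))) :
    subgradientImage w B = gradient (legendre w) ⁻¹' B := by
  ext y
  simp only [subgradientImage, mem_iUnion, mem_subgradient_iff_gradient_legendre_eq hm hw,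
    exists_prop, exists_eq_right', mem_preimage]

theorem bijective_gradient_of_strongConvexOn (hm : 0 < m) (hw : StrongConvexOn univ m w)
    {T : EuclideanSpace ℝ (Fin d) → EuclideanSpace ℝ (Fin d)}
    (hT : ∀ x, HasGradientAt w (T x) x) : Function.Bijective T := by
  have hmem : ∀ x, T x ∈ subgradient w x := fun x =>
    mem_subgradient_of_hasGradientAt (hw.convexOn fun r => by positivity) (hT x)
  refine Function.bijective_iff_has_inverse.2 ⟨gradient (legendre w), fun x => ?_, fun y => ?_⟩
  · exact (mem_subgradient_iff_gradient_legendre_eq hm hw).1 (hmem x)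
  · exact (eq_of_mem_subgradient_of_hasGradientAt
      ((mem_subgradient_iff_gradient_legendre_eq hm hw).2 rfl) (hT _)).symm

end Legendre

section Gronwall

theorem le_exp_mul_of_ae_deriv_le {D : ℝ → ℝ} {C a b : ℝ} (hab : a ≤ b)
    (hD : AbsolutelyContinuousOnInterval D a b)
    (hderiv : ∀ᵐ s ∂volume.restrict (Ioo a b), deriv D s ≤ C * D s) :
    D b ≤ Real.exp (C * (b - a)) * D a := by
  have hexp (s : ℝ) : HasDerivAt (fun r => Real.exp (-C * r)) (Real.exp (-C * s) * -C) s := by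
    simpa using ((hasDerivAt_id s).const_mul (-C)).exp
  have hac : AbsolutelyContinuousOnInterval ((fun s => Real.exp (-C * s)) * D) a b :=
    (ContDiffOn.absolutelyContinuousOnInterval (by fun_prop)).mul hD
  have hdecr : ∫ s in a..b, deriv ((fun s => Real.exp (-C * s)) * D) s ≤ 0 := by
    rw [intervalIntegral.integral_of_le hab, integral_Ioc_eq_integral_Ioo]
    refine integral_nonpos_of_ae ?_
    filter_upwards [hderiv, ae_restrict_of_ae hD.ae_differentiableAt,
      ae_restrict_mem measurableSet_Ioo] with s hle hdiff hs
    have hds := (hdiff (Ioo_subset_Icc_self.trans Icc_subset_uIcc hs)).hasDerivAt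
    rw [((hexp s).mul hds).deriv, Pi.zero_apply]
    linarith [mul_le_mul_of_nonneg_left hle (Real.exp_pos (-C * s)).le]
  rw [hac.integral_deriv_eq_sub, sub_nonpos, Pi.mul_apply, Pi.mul_apply] at hdecr
  have hscale := mul_le_mul_of_nonneg_left hdecr (Real.exp_pos (C * b)).le
  rw [← mul_assoc, ← mul_assoc, ← Real.exp_add, ← Real.exp_add] at hscale
  ring_nf at hscale ⊢
  simpa using hscale

theorem eq_zero_of_ae_inner_deriv_le {E : Type*} [NormedAddCommGroup E] [InnerProductSpace ℝ E]
    {W : ℝ → E} {C a b : ℝ} {L : NNReal} (hab : a ≤ b) (hW : LipschitzOnWith L W (Icc a b))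
    (ha : W a = 0)
    (hderiv : ∀ᵐ s ∂volume.restrict (Ioo a b),
      ∃ q, HasDerivAt W q s ∧ inner ℝ q (W s) ≤ C * ‖W s‖ ^ 2) : W b = 0 := by
  have hnorm : AbsolutelyContinuousOnInterval (fun s => ‖W s‖) a b := by
    rw [← uIcc_of_le hab] at hW
    exact (lipschitzWith_one_norm.comp_lipschitzOnWith hW).absolutelyContinuousOnInterval
  have hac : AbsolutelyContinuousOnInterval (fun s => ‖W s‖ ^ 2) a b := by
    simpa only [pow_two] using! hnorm.mul hnorm
  have hgronwall : ‖W b‖ ^ 2 ≤ Real.exp (2 * C * (b - a)) * ‖W a‖ ^ 2 := by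
    refine le_exp_mul_of_ae_deriv_le hab hac ?_
    filter_upwards [hderiv] with s ⟨q, hq, hle⟩
    rw [hq.norm_sq.deriv, real_inner_comm]
    linarith
  simpa [ha] using hgronwall

end Gronwall

section Flow

variable {d : ℕ} {lam s t : ℝ} {f : EuclideanSpace ℝ (Fin d) → ℝ}

theorem inner_sub_le_of_mem_differential {x x' q q' : EuclideanSpace ℝ (Fin d)}
    (hq : q ∈ differential lam f x) (hq' : q' ∈ differential lam f x') :
    inner ℝ (q - q') (x - x') ≤ lam * ‖x - x'‖ ^ 2 := by
  have h := hq x'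
  have h' := hq' x
  rw [← neg_sub x x', inner_neg_right, norm_neg] at h
  rw [inner_sub_left]
  linarith

theorem one_add_mul_pos_of_mem_Icc (hlam : 0 < 1 + lam * t) (hs : s ∈ Icc 0 t) :
    0 < 1 + lam * s := by
  rcases le_total 0 lam with h | h
  · linarith [mul_nonneg h hs.1]
  · linarith [mul_le_mul_of_nonpos_left hs.2 h]

theorem div_one_add_mul_le (hlam : 0 < 1 + lam * s) (hs : 0 ≤ s) : lam / (1 + lam * s) ≤ lam := by
  rw [div_le_iff₀ hlam]
  linarith [mul_nonneg hs (sq_nonneg lam)]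

theorem IsLagrangianFlow.eqOn (hlam : 0 < 1 + lam * t)
    {X Z : ℝ → EuclideanSpace ℝ (Fin d) → EuclideanSpace ℝ (Fin d)}
    (hX : IsLagrangianFlow lam f t X) (hZ : IsLagrangianFlow lam f t Z) :
    EqOn X Z (Icc 0 t) := by
  intro s hs
  funext y
  obtain ⟨L, hL⟩ := hX.lipschitz y
  obtain ⟨M, hM⟩ := hZ.lipschitz y
  have hsub : Ioo 0 s ⊆ Ioo 0 t := Ioo_subset_Ioo_right hs.2
  refine sub_eq_zero.1 (eq_zero_of_ae_inner_deriv_le (C := lam) hs.1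
    ((hL.sub hM).mono (Icc_subset_Icc_right hs.2)) (by simp [hX.initial, hZ.initial]) ?_)
  filter_upwards [ae_restrict_of_ae_restrict_of_subset hsub (hX.inclusion y),
    ae_restrict_of_ae_restrict_of_subset hsub (hZ.inclusion y),
    ae_restrict_mem measurableSet_Ioo] with r ⟨q, hq, hXq⟩ ⟨q', hq', hZq'⟩ hr
  refine ⟨q - q', hXq.sub hZq', (inner_sub_le_of_mem_differential hq hq').trans ?_⟩
  gcongr
  exact div_one_add_mul_le
    (one_add_mul_pos_of_mem_Icc hlam (Ioo_subset_Icc_self (hsub hr))) hr.1.le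

end Flow

section StreamPotential

variable {d : ℕ} {lam s t : ℝ} {φ : EuclideanSpace ℝ (Fin d) → ℝ}
  {p y : EuclideanSpace ℝ (Fin d)}

theorem lamConcave_streamPotential_iff (ht : 0 < t) :
    LamConcave (1 + lam * t) (streamPotential φ t) ↔ LamConcave lam φ := by
  have hscale : ∀ z, streamPotential φ t z - (1 + lam * t) / 2 * ‖z‖ ^ 2 =
      t * (φ z - lam / 2 * ‖z‖ ^ 2) := fun z => by
    rw [streamPotential]
    ring
  refine ⟨fun h => (h.smul (inv_nonneg.2 ht.le)).congr fun z _ => ?_,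
    fun h => (h.smul ht.le).congr fun z _ => (hscale z).symm⟩
  simp only [hscale, smul_eq_mul]
  rw [inv_mul_cancel_left₀ ht.ne']

theorem strongConvexOn_streamPotential (hs : 0 ≤ s) (ht : 0 < t)
    (hφ : ConvexOn ℝ univ (streamPotential φ t)) :
    StrongConvexOn univ (1 - s / t) (streamPotential φ s) := by
  refine strongConvexOn_iff_convex.2 ((hφ.smul (div_nonneg hs ht.le)).congr fun z _ => ?_)
  simp only [streamPotential, smul_eq_mul]
  field_simp
  ring

theorem hasGradientAt_streamPotential (hφ : HasGradientAt φ p y) (s : ℝ) :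
    HasGradientAt (streamPotential φ s) (y + s • p) y := by
  have hsq := hasGradientAt_div_two_mul_norm_sq 1 y
  rw [one_smul, hasGradientAt_iff_hasFDerivAt] at hsq
  rw [hasGradientAt_iff_hasFDerivAt, map_add, map_smul]
  exact hsq.add (hφ.hasFDerivAt.const_mul s)

theorem hasFiniteLegendre_streamPotential_of_lipschitzWith {K : NNReal} (hφ : LipschitzWith K φ)
    (ht : 0 ≤ t) : HasFiniteLegendre (streamPotential φ t) := by
  refine fun x => ⟨(‖x‖ + t * K) ^ 2 / 2 - t * φ 0, forall_mem_range.2 fun y => ?_⟩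
  have hlip := hφ.dist_le_mul y 0
  rw [Real.dist_eq, dist_zero_right] at hlip
  have hlow := mul_le_mul_of_nonneg_left (neg_le_of_abs_le hlip) ht
  rw [streamPotential]
  linarith [real_inner_le_norm x y, sq_nonneg (‖x‖ + t * K - ‖y‖)]

theorem streamPotential_modifiedPotential (ht : t ≠ 0) :
    streamPotential (modifiedPotential φ t) t = convexifiedPotential φ t := by
  funext y
  rw [streamPotential, modifiedPotential, mul_div_cancel₀ _ ht, add_sub_cancel]

theorem LamConcave.strongConvexOn_dualPotential (ht : 0 < t) (hlam : 0 < 1 + lam * t)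
    (hφ : LamConcave lam φ) (hfin : HasFiniteLegendre (streamPotential φ t)) :
    StrongConvexOn univ (1 + lam * t)⁻¹ (dualPotential φ t) :=
  ((lamConcave_streamPotential_iff ht).2 hφ).strongConvexOn_legendre hlam hfin

end StreamPotential

section HopfLax

variable {d : ℕ} {lam s t : ℝ} {f : EuclideanSpace ℝ (Fin d) → ℝ}
  {p y : EuclideanSpace ℝ (Fin d)}

theorem hopfLax_eq_dualPotential (hs : 0 < s) (hfin : HasFiniteLegendre (streamPotential f s))
    (x : EuclideanSpace ℝ (Fin d)) :
    hopfLax f s x = s⁻¹ * (1 / 2 * ‖x‖ ^ 2 - dualPotential f s x) := by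
  have hanti : Antitone fun r : ℝ => s⁻¹ * (1 / 2 * ‖x‖ ^ 2 - r) := fun r r' hr => by
    beta_reduce
    gcongr
  rw [dualPotential, legendre, hanti.map_ciSup_of_continuousAt (by fun_prop) (hfin x), hopfLax]
  refine iInf_congr fun y => ?_
  rw [streamPotential, norm_sub_sq_real]
  field_simp
  ring

theorem lamConcave_hopfLax (hs : 0 < s) (hlam : 0 < 1 + lam * s) (hf : LamConcave lam f)
    (hfin : HasFiniteLegendre (streamPotential f s)) :
    LamConcave (lam / (1 + lam * s)) (hopfLax f s) := by
  have hdual := strongConvexOn_iff_convex.1 (hf.strongConvexOn_dualPotential hs hlam hfin)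
  refine (hdual.neg.smul (inv_nonneg.2 hs.le)).congr fun x _ => ?_
  have hmod : (1 + lam * s)⁻¹ = 1 - s * (lam / (1 + lam * s)) := by
    field_simp [hlam.ne']
    ring
  simp only [hopfLax_eq_dualPotential hs hfin, Pi.neg_apply, smul_eq_mul, hmod]
  field_simp
  ring

theorem hasGradientAt_hopfLax (hs : 0 < s) {m : ℝ} (hm : 0 < m)
    (hconv : StrongConvexOn univ m (streamPotential f s)) (hp : HasGradientAt f p y) :
    HasGradientAt (hopfLax f s) p (y + s • p) := by
  have hmem : y + s • p ∈ subgradient (streamPotential f s) y :=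
    mem_subgradient_of_hasGradientAt (hconv.convexOn fun r => by positivity)
      (hasGradientAt_streamPotential hp s)
  have hdual : HasGradientAt (dualPotential f s) y (y + s • p) :=
    hasGradientAt_legendre_of_mem_subgradient hm hconv hmem
  have hsq := hasGradientAt_div_two_mul_norm_sq 1 (y + s • p)
  have heq : hopfLax f s = fun x => s⁻¹ * (1 / 2 * ‖x‖ ^ 2 - dualPotential f s x) :=
    funext (hopfLax_eq_dualPotential hs (hasFiniteLegendre_of_strongConvexOn hm hconv))
  have hslope : p = s⁻¹ • ((1 : ℝ) • (y + s • p) - y) := by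
    rw [one_smul, add_sub_cancel_left, inv_smul_smul₀ hs.ne']
  rw [heq, hasGradientAt_iff_hasFDerivAt]
  conv => arg 2; rw [hslope, map_smul, map_sub]
  exact (hsq.hasFDerivAt.sub hdual.hasFDerivAt).const_mul s⁻¹

theorem isLagrangianFlow_add_smul_gradient (hlam : 0 < 1 + lam * t) (hf : Differentiable ℝ f)
    (hconc : LamConcave lam f) (hconv : ConvexOn ℝ univ (streamPotential f t)) :
    IsLagrangianFlow lam f t fun s y => y + s • gradient f y where
  lipschitz y := ⟨‖gradient f y‖₊, LipschitzOnWith.of_dist_le_mul fun a _ b _ => by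
    rw [dist_add_left, dist_eq_norm, ← sub_smul, norm_smul, mul_comm, dist_eq_norm, coe_nnnorm]⟩
  initial y := by rw [zero_smul, add_zero]
  inclusion y := by
    filter_upwards [ae_restrict_mem measurableSet_Ioo] with s hs
    have hm : 0 < 1 - s / t := sub_pos.2 ((div_lt_one (hs.1.trans hs.2)).2 hs.2)
    have hstrong := strongConvexOn_streamPotential hs.1.le (hs.1.trans hs.2) hconv
    refine ⟨gradient f y, ?_, ?_⟩
    · exact (lamConcave_hopfLax hs.1 (one_add_mul_pos_of_mem_Icc hlam (Ioo_subset_Icc_self hs))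
        hconc (hasFiniteLegendre_of_strongConvexOn hm hstrong)).mem_differential_of_hasGradientAt
          (hasGradientAt_hopfLax hs.1 hm hstrong (hf y).hasGradientAt)
    · simpa using ((hasDerivAt_id s).smul_const (gradient f y)).const_add y

theorem bijective_add_smul_gradient (hf : Differentiable ℝ f)
    (hconv : ConvexOn ℝ univ (streamPotential f t)) (hs : s ∈ Ico 0 t) :
    Function.Bijective fun y => y + s • gradient f y :=
  have ht : 0 < t := hs.1.trans_lt hs.2
  bijective_gradient_of_strongConvexOn (sub_pos.2 ((div_lt_one ht).2 hs.2))
    (strongConvexOn_streamPotential hs.1 ht hconv)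
    fun y => hasGradientAt_streamPotential (hf y).hasGradientAt s

end HopfLax

section ModifiedPotential

variable {d : ℕ} {φ : EuclideanSpace ℝ (Fin d) → ℝ} {lam m t : ℝ}

theorem differentiable_modifiedPotential (h : Differentiable ℝ (convexifiedPotential φ t)) :
    Differentiable ℝ (modifiedPotential φ t) := by
  have hsub : Differentiable ℝ fun y => convexifiedPotential φ t y - 1 / 2 * ‖y‖ ^ 2 :=
    h.sub ((differentiable_id.norm_sq ℝ).const_mul (1 / 2))
  exact hsub.mul_const t⁻¹

theorem lamConcave_modifiedPotential (ht : 0 < t) (hlam : 0 < 1 + lam * t)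
    (hw : StrongConvexOn univ (1 + lam * t)⁻¹ (dualPotential φ t)) :
    LamConcave lam (modifiedPotential φ t) := by
  rw [← lamConcave_streamPotential_iff ht, streamPotential_modifiedPotential ht.ne',
    ← inv_inv (1 + lam * t)]
  exact lamConcave_legendre_of_strongConvexOn (inv_pos.2 hlam) hw

theorem convexOn_streamPotential_modifiedPotential (ht : t ≠ 0) (hm : 0 < m)
    (hw : StrongConvexOn univ m (dualPotential φ t)) :
    ConvexOn ℝ univ (streamPotential (modifiedPotential φ t) t) := by
  rw [streamPotential_modifiedPotential ht]
  exact (hasFiniteLegendre_of_strongConvexOn hm hw).convexOn_legendre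

theorem add_smul_gradient_modifiedPotential (ht : t ≠ 0)
    (hdiff : Differentiable ℝ (modifiedPotential φ t)) (y : EuclideanSpace ℝ (Fin d)) :
    y + t • gradient (modifiedPotential φ t) y = transportMap φ t y := by
  have hgrad := hasGradientAt_streamPotential (hdiff y).hasGradientAt t
  rw [streamPotential_modifiedPotential ht] at hgrad
  exact hgrad.gradient.symm

theorem map_transportMap_eq_mongeAmpere (hm : 0 < m)
    (hw : StrongConvexOn univ m (dualPotential φ t)) {B : Set (EuclideanSpace ℝ (Fin d))}
    (hB : MeasurableSet B) :
    MeasurableSet (subgradientImage (dualPotential φ t) B) ∧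
      Measure.map (transportMap φ t) volume B = mongeAmpere (dualPotential φ t) B := by
  have hT : Measurable (transportMap φ t) := measurable_gradient _
  rw [mongeAmpere, subgradientImage_eq_preimage_gradient_legendre hm hw]
  exact ⟨hT hB, Measure.map_apply hT hB⟩

end ModifiedPotential

theorem theorem5_general {d : ℕ} (φ : EuclideanSpace ℝ (Fin d) → ℝ) (lam t : ℝ) (ht : 0 < t)
    (hlam : 0 < 1 + lam * t) (hconc : LamConcave lam φ)
    (hfin : HasFiniteLegendre (streamPotential φ t)) :
    Differentiable ℝ (convexifiedPotential φ t) ∧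
    Differentiable ℝ (modifiedPotential φ t) ∧
    (∃ X, IsLagrangianFlow lam (modifiedPotential φ t) t X) ∧
    ∀ X, IsLagrangianFlow lam (modifiedPotential φ t) t X →
      (∀ s ∈ Set.Ico 0 t, Function.Bijective (X s) ∧
        ∀ y, X s y = y + s • gradient (modifiedPotential φ t) y) ∧
      (∀ y, X t y = transportMap φ t y) ∧
      (∀ s ∈ Set.Icc 0 t, Measurable (X s)) ∧
      (∀ B : Set (EuclideanSpace ℝ (Fin d)), MeasurableSet B →
        MeasurableSet (subgradientImage (dualPotential φ t) B) ∧
        MeasureTheory.Measure.map (X t) MeasureTheory.volume B =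
          mongeAmpere (dualPotential φ t) B) := by
  have hm : 0 < (1 + lam * t)⁻¹ := inv_pos.2 hlam
  have hw := hconc.strongConvexOn_dualPotential ht hlam hfin
  have hdiff_conv : Differentiable ℝ (convexifiedPotential φ t) := differentiable_legendre hm hw
  have hdiff := differentiable_modifiedPotential hdiff_conv
  have hconv := convexOn_streamPotential_modifiedPotential ht.ne' hm hw
  have hflow := isLagrangianFlow_add_smul_gradient hlam hdiff
    (lamConcave_modifiedPotential ht hlam hw) hconv
  refine ⟨hdiff_conv, hdiff, ⟨_, hflow⟩, fun X hX => ?_⟩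
  have hX_eq := hX.eqOn hlam hflow
  have hX_t : X t = transportMap φ t := by
    rw [hX_eq (right_mem_Icc.2 ht.le)]
    exact funext (add_smul_gradient_modifiedPotential ht.ne' hdiff)
  refine ⟨fun s hs => ?_, congr_fun hX_t, fun s hs => ?_, fun B hB => ?_⟩
  · rw [hX_eq (Ico_subset_Icc_self hs)]
    exact ⟨bijective_add_smul_gradient hdiff hconv hs, fun y => rfl⟩
  · rw [hX_eq hs]
    exact measurable_id.add ((measurable_gradient _).const_smul s)
  · rw [hX_t]
    exact map_transportMap_eq_mongeAmpere hm hw hB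

theorem theorem5 {d : ℕ} (φ : EuclideanSpace ℝ (Fin d) → ℝ) (K : NNReal) (lam : ℝ)
    (hlam : 0 ≤ lam) (hLip : LipschitzWith K φ) (hconc : LamConcave lam φ)
    (t : ℝ) (ht : 0 < t) :
    -- the gradients in the statement exist
    Differentiable ℝ (convexifiedPotential φ t) ∧
    Differentiable ℝ (modifiedPotential φ t) ∧
    -- the modified flow exists, and any solution of the differential inclusion is as described
    (∃ X, IsLagrangianFlow lam (modifiedPotential φ t) t X) ∧
    ∀ X, IsLagrangianFlow lam (modifiedPotential φ t) t X →
      (∀ s ∈ Set.Ico 0 t, Function.Bijective (X s) ∧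
        ∀ y, X s y = y + s • gradient (modifiedPotential φ t) y) ∧
      (∀ y, X t y = transportMap φ t y) ∧
      (∀ s ∈ Set.Icc 0 t, Measurable (X s)) ∧
      (∀ B : Set (EuclideanSpace ℝ (Fin d)), MeasurableSet B →
        MeasurableSet (subgradientImage (dualPotential φ t) B) ∧
        MeasureTheory.Measure.map (X t) MeasureTheory.volume B =
          mongeAmpere (dualPotential φ t) B) := by
  exact theorem5_general φ lam t ht (by positivity) hconc
    (hasFiniteLegendre_streamPotential_of_lipschitzWith hLip ht.le)
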